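/- In the hyperbolic plane $H^2$ (curvature $-1$, distance $d$, geodesic segments $[x,y]$), a supporting line of a convex body $K$ is a line that meets $K$ and bounds a closed half-plane containing $K$. The width of $K$ with respect to a supporting line $\ell$ is the largest distance between $\ell$ and a supporting line $\ell'$ of $K$, and the thickness of $K$ is the minimum of these widths over all supporting lines $\ell$. Let $n$ be odd and let $P$ be a convex $n$-gon in $H^2$ of thickness $w$, with vertices $v_1,\dots,v_n$ in cyclic order with respect to the positive orientation (indices mod $n$). Assume that $P$ is an ordinary reduced $n$-gon, that is, for each $i$ the vertex $v_i$ has distance $w$ from the opposite side $\left[v_{i+\frac{n-1}{2}},v_{i+\frac{n+1}{2}}\right]$, and the orthogonal projection $t_i$ of $v_i$ on the line through $v_{i+\frac{n-1}{2}}$ and $v_{i+\frac{n+1}{2}}$ lies in the relative interior of this side. Then, for each $i$, the segments $[v_i,t_i]$ and $\left[v_{i+\frac{n+1}{2}},t_{i+\frac{n+1}{2}}\right]$ have exactly one common point $p_i$, and, with $$\varphi_i=\angle\left(v_i,p_i,t_{i+\frac{n+1}{2}}\right)$$ (the angle at $p_i$), $$g_w(x)=\frac{1+\cos x-\sqrt{(1+\cos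 x)^2-4\tanh^2 w\,\cos x}}{2\tanh w},\qquad p_w(x)=\operatorname{arcosh}\left(\frac{1-g_w(x)\tanh w}{\sqrt{1-\tanh^2 w}}\right),$$ the perimeter of $P$ (the sum of its side lengths) is $$\operatorname{perim}(P)=\sum_{i=1}^n d(v_i,v_{i+1})=2\sum_{i=1}^n p_w(\varphi_i).$$ -/

import Mathlib

open UpperHalfPlane

noncomputable section

namespace HypPolygon

/-! The hyperbolic plane is Mathlib's upper half-plane `ℍ` with its hyperbolic metric (of curvature
`-1`). -/

/-- The geodesic segment `[x, y]`. -/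
def segment (x y : ℍ) : Set ℍ := {z | dist x z + dist z y = dist x y}

/-- The relative interior of the geodesic segment `[x, y]`, for `x ≠ y`. -/
def openSegment (x y : ℍ) : Set ℍ := segment x y \ {x, y}

/-- The hyperbolic line through `a` and `b`, for `a ≠ b`: the points that are collinear with them. -/
def line (a b : ℍ) : Set ℍ := {z | z ∈ segment a b ∨ a ∈ segment z b ∨ b ∈ segment a z}

/-- The coordinate of `z` in the Poincaré disk model centred at `p`. The map `z ↦ diskCoord p z` is
an orientation-preserving conformal isometry of the half-plane model onto the disk model that takes
`p` to `0`, so the geodesics through `p` become the straight lines through `0`. -/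
def diskCoord (p z : ℍ) : ℂ := ((z : ℂ) - p) / ((z : ℂ) - (starRingEnd ℂ) (p : ℂ))

/-- The angle at `p` between the geodesic rays from `p` to `x` and from `p` to `y`, for `x, y ≠ p`.
(If `x = p` or `y = p` the value is `π / 2`.) -/
def angle (x p y : ℍ) : ℝ := InnerProductGeometry.angle (diskCoord p x) (diskCoord p y)

/-- Positive, zero or negative according as `z` lies to the left of, on, or to the right of the
line through `a` and `b` directed from `a` to `b`, for `a ≠ b`. -/
def side (a b z : ℍ) : ℝ := ((starRingEnd ℂ) (diskCoord a b) * diskCoord a z).im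

/-- `t` is the orthogonal projection of `x` on the line `ℓ`: the foot of the perpendicular from `x`
to `ℓ` (this is `x` itself if `x ∈ ℓ`). -/
def IsOrthogonalProjection (x : ℍ) (ℓ : Set ℍ) (t : ℍ) : Prop :=
  t ∈ ℓ ∧ ∀ z ∈ ℓ, angle x t z = Real.pi / 2

/-- Hyperbolic convexity. -/
def IsConvex (S : Set ℍ) : Prop := ∀ x ∈ S, ∀ y ∈ S, segment x y ⊆ S

/-- The hyperbolic convex hull. -/
def convHull (X : Set ℍ) : Set ℍ := ⋂₀ {S | IsConvex S ∧ X ⊆ S}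

/-- `ℓ` is a supporting line of `K`: a line that meets `K` and such that `K` is contained in one of
the closed half-planes bounded by `ℓ`. (Exchanging `a` and `b` exchanges the half-planes.) -/
def IsSupportingLine (K ℓ : Set ℍ) : Prop :=
  ∃ a b : ℍ, a ≠ b ∧ ℓ = line a b ∧ (K ∩ ℓ).Nonempty ∧ ∀ z ∈ K, 0 ≤ side a b z

/-- The distance of two lines. -/
def lineDist (ℓ ℓ' : Set ℍ) : ℝ := sInf (Set.image2 dist ℓ ℓ')

/-- The width of the convex body `K` with respect to its supporting line `ℓ`: the distance from `ℓ`
to a most distant supporting line of `K`. -/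
def width (K ℓ : Set ℍ) : ℝ := sSup (lineDist ℓ '' {ℓ' | IsSupportingLine K ℓ'})

/-- The thickness (minimal width) of the convex body `K`. -/
def thickness (K : Set ℍ) : ℝ := sInf (width K '' {ℓ | IsSupportingLine K ℓ})

/-- `v` lists, in cyclic order with respect to the positive orientation, the vertices of an `n`-gon:
the convex hull is a convex body, no `v i` is in the convex hull of the others, and any three
vertices in cyclic order form a positively oriented triangle. -/
structure IsPolygon {n : ℕ} (v : ZMod n → ℍ) : Prop where
  interior_nonempty : (interior (convHull (Set.range v))).Nonempty
  vertex : ∀ i, v i ∉ convHull (v '' {j | j ≠ i})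
  positive : ∀ i j k : ZMod n, i.val < j.val → j.val < k.val → 0 < side (v i) (v j) (v k)

/-- `v` lists, in cyclic order with respect to the positive orientation, the vertices of an ordinary
reduced `n`-gon: `n` is odd, and each vertex has distance equal to the thickness of the polygon from
the opposite side, its orthogonal projection on the line of that side being in the relative interior
of the side. -/
structure IsOrdinaryReduced {n : ℕ} (v : ZMod n → ℍ) : Prop where
  odd : Odd n
  isPolygon : IsPolygon v
  dist_side : ∀ i : ZMod n,
    Metric.infDist (v i) (segment (v (i + ((n - 1) / 2 : ℕ))) (v (i + ((n + 1) / 2 : ℕ)))) =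
      thickness (convHull (Set.range v))
  foot : ∀ i : ZMod n,
    ∃ t ∈ openSegment (v (i + ((n - 1) / 2 : ℕ))) (v (i + ((n + 1) / 2 : ℕ))),
      IsOrthogonalProjection (v i) (line (v (i + ((n - 1) / 2 : ℕ))) (v (i + ((n + 1) / 2 : ℕ)))) t

/-- The perimeter of the polygon with vertices `v i` in cyclic order. -/
def perimeter {n : ℕ} [NeZero n] (v : ZMod n → ℍ) : ℝ := ∑ i, dist (v i) (v (i + 1))

/-- The function `g_w`. -/
def gFun (w x : ℝ) : ℝ :=
  (1 + Real.cos x - √((1 + Real.cos x) ^ 2 - 4 * Real.tanh w ^ 2 * Real.cos x)) /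
    (2 * Real.tanh w)

/-- The function `p_w`. -/
def pFun (w x : ℝ) : ℝ :=
  Real.arcosh ((1 - gFun w x * Real.tanh w) / √(1 - Real.tanh w ^ 2))

end HypPolygon

end

open UpperHalfPlane

noncomputable section

namespace HypPolygon

/-! ### The hyperboloid model in light cone coordinates -/

/-! Write n = 2m + 1 and j = i + m + 1. The side opposite v_i ends at v_j, and the side opposite v_j
is [v_i, v_{i+1}]. Hence t_i v_i v_j and t_j v_j v_i are right triangles with common hypotenuse
[v_i, v_j] and equal legs w, so d(v_i, t_j) = d(v_j, t_i). The cevians cross at p_i, and the right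
triangles v_i p_i t_j and v_j p_i t_i are congruent; in the former, hypotenuse plus leg at p_i is
therefore w. With its angle φ_i this determines the opposite leg, d(v_i, t_j) = p_w(φ_i)
(`dist_eq_pFun_of_perpendiculars`, `pFun_add_eq`).

The foot t_j splits [v_i, v_{i+1}]. Its first part is p_w(φ_i); its second, by the equality of legs
at index j, is p_w(φ_j). Since i ↦ j permutes the indices, summing gives twice the sum of the
p_w(φ_i).

Incidence is linear algebra in the hyperboloid model: segments are nonnegative combinations,
orientation is the sign of a determinant, and the crossing (`IsPolygon.cevians_crossing`) follows
from the positivity of the vertex determinants. -/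

/-- The point of the hyperboloid `X 0 * X 2 - X 1 ^ 2 = 1` that corresponds to `z`. -/
def hyperboloid (z : ℍ) : Fin 3 → ℝ := ![1 / z.im, z.re / z.im, (z.re ^ 2 + z.im ^ 2) / z.im]

/-- The Lorentz form, normalised to be `1` on the hyperboloid. -/
def lorentz (X Y : Fin 3 → ℝ) : ℝ := (X 0 * Y 2 + X 2 * Y 0) / 2 - X 1 * Y 1

/-- The determinant of three vectors. -/
def det3 (X Y Z : Fin 3 → ℝ) : ℝ :=
  X 0 * (Y 1 * Z 2 - Y 2 * Z 1) - X 1 * (Y 0 * Z 2 - Y 2 * Z 0) + X 2 * (Y 0 * Z 1 - Y 1 * Z 0)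

theorem lorentz_comm (X Y : Fin 3 → ℝ) : lorentz X Y = lorentz Y X := by
  simp only [lorentz]; ring

theorem lorentz_hyperboloid (z w : ℍ) :
    lorentz (hyperboloid z) (hyperboloid w) = Real.cosh (dist z w) := by
  rw [UpperHalfPlane.cosh_dist']
  have := z.im_pos.ne'
  have := w.im_pos.ne'
  simp [lorentz, hyperboloid]
  field_simp
  ring

theorem lorentz_hyperboloid_self (z : ℍ) : lorentz (hyperboloid z) (hyperboloid z) = 1 := by
  simp [lorentz_hyperboloid]

theorem hyperboloid_injective : Function.Injective hyperboloid := by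
  intro z w h
  have h1 := lorentz_hyperboloid z w
  rw [h, lorentz_hyperboloid_self] at h1
  have h2 : ¬ 1 < Real.cosh (dist z w) := h1.ge.not_gt
  rw [Real.one_lt_cosh, not_not] at h2
  exact dist_eq_zero.mp h2

theorem exists_hyperboloid_eq {X : Fin 3 → ℝ} (h0 : 0 < X 0) (h : lorentz X X = 1) :
    ∃ z : ℍ, hyperboloid z = X := by
  refine ⟨⟨⟨X 1 / X 0, 1 / X 0⟩, by simpa using h0⟩, ?_⟩
  have h' : X 0 * X 2 - X 1 * X 1 = 1 := by simp only [lorentz] at h; linarith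
  ext i
  fin_cases i
  · simp [hyperboloid]
  · simp [hyperboloid]
    field_simp
  · simp [hyperboloid]
    field_simp
    linarith

theorem hyperboloid_zero_pos (z : ℍ) : 0 < hyperboloid z 0 := by
  have := z.im_pos
  simpa [hyperboloid] using this

/-- The form is negative definite on the orthogonal complement of a timelike vector. The identity
`e` exhibits this as a sum of squares. -/
theorem eq_zero_of_lorentz_eq_zero (z : ℍ) {V : Fin 3 → ℝ} (h : lorentz V (hyperboloid z) = 0)
    (hV : lorentz V V = 0) : V = 0 := by
  have h0 := hyperboloid_zero_pos z
  have h1 := lorentz_hyperboloid_self z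
  set X := hyperboloid z
  simp only [lorentz] at h h1 hV
  have e : (X 0 * V 1 - X 1 * V 0) ^ 2 + V 0 ^ 2 = 0 := by
    linear_combination (-V 0 ^ 2) * h1 - X 0 ^ 2 * hV + 2 * V 0 * X 0 * h
  have hV0 : V 0 = 0 := by nlinarith [sq_nonneg (X 0 * V 1 - X 1 * V 0), sq_nonneg (V 0)]
  have hV1 : V 1 = 0 := by
    rw [hV0] at hV
    nlinarith [sq_nonneg (V 1)]
  have hV2 : V 2 = 0 := by
    rw [hV0, hV1] at h
    have : X 0 * V 2 = 0 := by linarith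
    exact (mul_eq_zero.mp this).resolve_left h0.ne'
  ext i
  fin_cases i <;> simp [hV0, hV1, hV2]

/-! ### Angles and orientation -/

/-- The initial vector at `p`, of length `sinh (dist p z)`, of the geodesic from `p` to `z`. -/
def tangentTo (p z : ℍ) : ℂ :=
  ⟨((z.re - p.re) ^ 2 + z.im ^ 2 - p.im ^ 2) / (2 * p.im * z.im), (p.re - z.re) / z.im⟩

/-- Positive factors affect neither angles nor the sign of `side`, so `tangentTo` can replace
`diskCoord`; its products are polynomial in the hyperboloid coordinates. -/
theorem diskCoord_eq_smul (p z : ℍ) :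
    diskCoord p z = (2 * p.im * z.im / ((z.re - p.re) ^ 2 + (z.im + p.im) ^ 2)) • tangentTo p z := by
  have hz := z.im_pos
  have hp := p.im_pos
  have hN : (z.re - p.re) ^ 2 + (z.im + p.im) ^ 2 ≠ 0 := by positivity
  have hne : (z : ℂ) - (starRingEnd ℂ) (p : ℂ) ≠ 0 := by
    intro h
    have := congrArg Complex.im h
    simp at this
    linarith
  rw [diskCoord, div_eq_iff hne, smul_mul_assoc]
  apply Complex.ext
  · simp only [tangentTo, Complex.smul_re, Complex.sub_re, Complex.sub_im, Complex.mul_re,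
      Complex.conj_re, Complex.conj_im, smul_eq_mul, coe_re, coe_im]
    field_simp
    ring
  · simp only [tangentTo, Complex.smul_im, Complex.sub_re, Complex.sub_im, Complex.mul_im,
      Complex.conj_re, Complex.conj_im, smul_eq_mul, coe_re, coe_im]
    field_simp
    ring

theorem inner_tangentTo (p x y : ℍ) : inner ℝ (tangentTo p x) (tangentTo p y) =
    Real.cosh (dist x p) * Real.cosh (dist p y) - Real.cosh (dist x y) := by
  have := x.im_pos.ne'
  have := y.im_pos.ne'
  have := p.im_pos.ne'
  rw [Complex.inner, ← lorentz_hyperboloid, ← lorentz_hyperboloid, ← lorentz_hyperboloid]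
  simp [tangentTo, lorentz, hyperboloid]
  field_simp
  ring

theorem norm_tangentTo (p x : ℍ) : ‖tangentTo p x‖ = Real.sinh (dist p x) := by
  have h := inner_tangentTo p x x
  rw [real_inner_self_eq_norm_sq, dist_self, Real.cosh_zero, dist_comm x p] at h
  have h2 : ‖tangentTo p x‖ ^ 2 = Real.sinh (dist p x) ^ 2 := by
    rw [h, Real.sinh_sq]; ring
  exact (sq_eq_sq₀ (norm_nonneg _) (Real.sinh_nonneg_iff.mpr dist_nonneg)).mp h2

theorem diskFactor_pos (p z : ℍ) :
    0 < 2 * p.im * z.im / ((z.re - p.re) ^ 2 + (z.im + p.im) ^ 2) := by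
  have hz := z.im_pos
  have hp := p.im_pos
  positivity

theorem angle_eq_angle_tangentTo (x p y : ℍ) :
    angle x p y = InnerProductGeometry.angle (tangentTo p x) (tangentTo p y) := by
  rw [angle, diskCoord_eq_smul, diskCoord_eq_smul,
    InnerProductGeometry.angle_smul_left_of_pos _ _ (diskFactor_pos p x),
    InnerProductGeometry.angle_smul_right_of_pos _ _ (diskFactor_pos p y)]

/-- The hyperbolic law of cosines. -/
theorem cos_angle_mul_sinh_mul_sinh (x p y : ℍ) :
    Real.cos (angle x p y) * (Real.sinh (dist p x) * Real.sinh (dist p y)) =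
      Real.cosh (dist x p) * Real.cosh (dist p y) - Real.cosh (dist x y) := by
  rw [angle_eq_angle_tangentTo, ← norm_tangentTo, ← norm_tangentTo,
    InnerProductGeometry.cos_angle_mul_norm_mul_norm, inner_tangentTo]

/-- The hyperbolic theorem of Pythagoras. -/
theorem cosh_dist_of_angle_eq_pi_div_two {x p y : ℍ} (h : angle x p y = Real.pi / 2) :
    Real.cosh (dist x y) = Real.cosh (dist x p) * Real.cosh (dist p y) := by
  have := cos_angle_mul_sinh_mul_sinh x p y
  rw [h, Real.cos_pi_div_two] at this
  linarith

theorem side_eq_mul_det3 (a b z : ℍ) :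
    ∃ c, 0 < c ∧ side a b z = c * det3 (hyperboloid a) (hyperboloid b) (hyperboloid z) := by
  have ha := a.im_pos
  have hb := b.im_pos.ne'
  have hz := z.im_pos.ne'
  -- The constant is the product of the two disk factors and the 1/2 from `key`.
  refine ⟨_, mul_pos (mul_pos (diskFactor_pos a b) (diskFactor_pos a z)) (half_pos one_pos), ?_⟩
  rw [side, diskCoord_eq_smul, diskCoord_eq_smul]
  have key : ((starRingEnd ℂ) (tangentTo a b) * tangentTo a z).im =
      1 / 2 * det3 (hyperboloid a) (hyperboloid b) (hyperboloid z) := by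
    simp [tangentTo, det3, hyperboloid]
    field_simp
    ring
  rw [mul_assoc _ (1 / 2), ← key]
  generalize 2 * a.im * b.im / ((b.re - a.re) ^ 2 + (b.im + a.im) ^ 2) = r
  generalize 2 * a.im * z.im / ((z.re - a.re) ^ 2 + (z.im + a.im) ^ 2) = s
  simp
  ring

theorem side_pos_iff (a b z : ℍ) :
    0 < side a b z ↔ 0 < det3 (hyperboloid a) (hyperboloid b) (hyperboloid z) := by
  obtain ⟨c, hc, h⟩ := side_eq_mul_det3 a b z
  rw [h]
  exact mul_pos_iff_of_pos_left hc

theorem det3_rotate (X Y Z : Fin 3 → ℝ) : det3 X Y Z = det3 Y Z X := by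
  simp only [det3]; ring

/-! ### Segments -/

/-- The difference `V` of the two sides is orthogonal to x, q and y by the addition formulas. Being
a combination of these, it is isotropic, and orthogonality to q makes it zero. -/
theorem sinh_dist_smul_of_mem_segment {x y q : ℍ} (h : q ∈ segment x y) :
    Real.sinh (dist x y) • hyperboloid q =
      Real.sinh (dist q y) • hyperboloid x + Real.sinh (dist x q) • hyperboloid y := by
  have h : dist x q + dist q y = dist x y := h
  rw [← sub_eq_zero]
  have hxq := lorentz_hyperboloid x q
  have hqy := lorentz_hyperboloid q y
  have hxy := lorentz_hyperboloid x y
  have hxx := lorentz_hyperboloid_self x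
  have hqq := lorentz_hyperboloid_self q
  have hyy := lorentz_hyperboloid_self y
  rw [← h] at hxy ⊢
  rw [Real.cosh_add] at hxy
  rw [Real.sinh_add]
  have s1 := Real.cosh_sq (dist x q)
  have s2 := Real.cosh_sq (dist q y)
  set c := Real.cosh (dist x q)
  set s := Real.sinh (dist x q)
  set c' := Real.cosh (dist q y)
  set s' := Real.sinh (dist q y)
  set V := (s * c' + c * s') • hyperboloid q - (s' • hyperboloid x + s • hyperboloid y) with hV
  have expand : ∀ Z, lorentz V Z = (s * c' + c * s') * lorentz (hyperboloid q) Z -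
      s' * lorentz (hyperboloid x) Z - s * lorentz (hyperboloid y) Z := by
    intro Z
    simp only [lorentz, hV, Pi.sub_apply, Pi.add_apply, Pi.smul_apply, smul_eq_mul]
    ring
  have hVx : lorentz V (hyperboloid x) = 0 := by
    rw [expand, hxx, lorentz_comm _ (hyperboloid x), lorentz_comm _ (hyperboloid x), hxq, hxy]
    linear_combination s' * s1
  have hVq : lorentz V (hyperboloid q) = 0 := by
    rw [expand, hxq, hqq, lorentz_comm _ (hyperboloid q), hqy]
    ring
  have hVy : lorentz V (hyperboloid y) = 0 := by
    rw [expand, hxy, hqy, hyy]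
    linear_combination s * s2
  refine eq_zero_of_lorentz_eq_zero q hVq ?_
  rw [expand, lorentz_comm _ V, lorentz_comm _ V, lorentz_comm _ V, hVx, hVy, hVq]
  ring

/-- Pairing with q, x and y identifies β and α as ratios of hyperbolic sines; the addition formula
for cosh then gives additivity of the distances. -/
theorem mem_segment_of_hyperboloid_eq {x y q : ℍ} {α β : ℝ} (hα : 0 ≤ α) (hβ : 0 ≤ β)
    (h : hyperboloid q = α • hyperboloid x + β • hyperboloid y) : q ∈ segment x y := by
  have expand : ∀ Z, lorentz (hyperboloid q) Z =
      α * lorentz (hyperboloid x) Z + β * lorentz (hyperboloid y) Z := by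
    intro Z
    simp only [lorentz, h, Pi.add_apply, Pi.smul_apply, smul_eq_mul]
    ring
  have h1 := expand (hyperboloid q)
  have h2 := expand (hyperboloid x)
  have h3 := expand (hyperboloid y)
  simp only [lorentz_hyperboloid, dist_self, Real.cosh_zero] at h1 h2 h3
  rw [dist_comm y q] at h1
  rw [dist_comm q x, dist_comm y x] at h2
  rw [h2, h3] at h1
  have hs : Real.cosh (dist x y) ^ 2 = Real.sinh (dist x y) ^ 2 + 1 := Real.cosh_sq _
  have hs0 : 0 ≤ Real.sinh (dist x y) := Real.sinh_nonneg_iff.mpr dist_nonneg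
  have e1 : Real.sinh (dist x q) = β * Real.sinh (dist x y) := by
    refine (sq_eq_sq₀ (Real.sinh_nonneg_iff.mpr dist_nonneg) (by positivity)).mp ?_
    rw [Real.sinh_sq, h2]
    linear_combination β ^ 2 * hs - h1
  have e2 : Real.sinh (dist q y) = α * Real.sinh (dist x y) := by
    refine (sq_eq_sq₀ (Real.sinh_nonneg_iff.mpr dist_nonneg) (by positivity)).mp ?_
    rw [Real.sinh_sq, h3]
    linear_combination α ^ 2 * hs - h1
  have e3 : Real.cosh (dist x q + dist q y) = Real.cosh (dist x y) := by
    rw [Real.cosh_add, h2, h3, e1, e2]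
    linear_combination - Real.cosh (dist x y) * h1 - α * β * hs
  exact Real.cosh_strictMonoOn.injOn (Set.mem_Ici.mpr (by positivity))
    (Set.mem_Ici.mpr dist_nonneg) e3

theorem left_mem_segment (x y : ℍ) : x ∈ segment x y := by simp [segment]

theorem right_mem_segment (x y : ℍ) : y ∈ segment x y := by simp [segment]

theorem cosh_dist_injective {x y z w : ℍ} (h : Real.cosh (dist x y) = Real.cosh (dist z w)) :
    dist x y = dist z w :=
  Real.cosh_strictMonoOn.injOn (Set.mem_Ici.mpr dist_nonneg) (Set.mem_Ici.mpr dist_nonneg) h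

/-! ### Crossing segments -/

theorem det3_add_smul (X Y U V : Fin 3 → ℝ) (a b : ℝ) :
    det3 X Y (a • U + b • V) = a * det3 X Y U + b * det3 X Y V := by
  simp only [det3, Pi.add_apply, Pi.smul_apply, smul_eq_mul]; ring

theorem det3_smul (X Y U : Fin 3 → ℝ) (a : ℝ) : det3 X Y (a • U) = a * det3 X Y U := by
  simp only [det3, Pi.smul_apply, smul_eq_mul]; ring

theorem det3_right_self (X Y : Fin 3 → ℝ) : det3 X Y Y = 0 := by
  simp only [det3]; ring

theorem det3_swap (X Y Z : Fin 3 → ℝ) : det3 X Z Y = -det3 X Y Z := by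
  simp only [det3]; ring

theorem det3_eq_zero_of_mem_segment {x y q : ℍ} (hxy : x ≠ y) (h : q ∈ segment x y) :
    det3 (hyperboloid x) (hyperboloid y) (hyperboloid q) = 0 := by
  have h1 := congrArg (det3 (hyperboloid x) (hyperboloid y)) (sinh_dist_smul_of_mem_segment h)
  rw [det3_smul, det3_add_smul, det3_right_self,
    det3_rotate _ _ (hyperboloid x), det3_right_self] at h1
  have : Real.sinh (dist x y) ≠ 0 := by simpa using hxy
  simpa [this] using h1

/-- The coefficients of a point of the segment `[a, t]` that lies on the line through `b` and `s`. -/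
theorem sinh_dist_mul_det3_of_mem_segment_inter {a t b s q : ℍ} (hbs : b ≠ s)
    (h : q ∈ segment a t ∩ segment b s) :
    Real.sinh (dist q t) * det3 (hyperboloid b) (hyperboloid s) (hyperboloid a) +
      Real.sinh (dist a q) * det3 (hyperboloid b) (hyperboloid s) (hyperboloid t) = 0 := by
  have h1 := congrArg (det3 (hyperboloid b) (hyperboloid s)) (sinh_dist_smul_of_mem_segment h.1)
  rw [det3_smul, det3_add_smul, det3_eq_zero_of_mem_segment hbs h.2, mul_zero] at h1
  exact h1.symm

theorem dist_pos_of_mem_segment_inter {a t b s q : ℍ} (hat : a ≠ t) (hbs : b ≠ s)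
    (hD : det3 (hyperboloid b) (hyperboloid s) (hyperboloid a) *
      det3 (hyperboloid b) (hyperboloid s) (hyperboloid t) < 0)
    (h : q ∈ segment a t ∩ segment b s) : 0 < dist a q ∧ 0 < dist q t := by
  have h1 := sinh_dist_mul_det3_of_mem_segment_inter hbs h
  have hl : dist a q + dist q t = dist a t := h.1
  have hD1 := left_ne_zero_of_mul hD.ne
  have hD2 := right_ne_zero_of_mul hD.ne
  have hpos : 0 < dist a t := dist_pos.mpr hat
  constructor
  · refine lt_of_le_of_ne dist_nonneg fun h0 => ?_
    rw [← h0, Real.sinh_zero, zero_mul, add_zero, mul_eq_zero, or_iff_left hD1,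
      Real.sinh_eq_zero] at h1
    linarith
  · refine lt_of_le_of_ne dist_nonneg fun h0 => ?_
    rw [← h0, Real.sinh_zero, zero_mul, zero_add, mul_eq_zero, or_iff_left hD2,
      Real.sinh_eq_zero] at h1
    linarith

/-- The line through b and s fixes the ratio of the coefficients on a and t, so q and q' are
proportional vectors; both have Lorentz norm 1. -/
theorem eq_of_mem_segment_inter {a t b s q q' : ℍ} (hat : a ≠ t) (hbs : b ≠ s)
    (hD : det3 (hyperboloid b) (hyperboloid s) (hyperboloid a) *
      det3 (hyperboloid b) (hyperboloid s) (hyperboloid t) < 0)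
    (h : q ∈ segment a t ∩ segment b s) (h' : q' ∈ segment a t ∩ segment b s) : q = q' := by
  have e := sinh_dist_mul_det3_of_mem_segment_inter hbs h
  have e' := sinh_dist_mul_det3_of_mem_segment_inter hbs h'
  have p := Real.sinh_pos_iff.mpr (dist_pos_of_mem_segment_inter hat hbs hD h).2
  have p' := Real.sinh_pos_iff.mpr (dist_pos_of_mem_segment_inter hat hbs hD h').2
  have l := sinh_dist_smul_of_mem_segment h.1
  have l' := sinh_dist_smul_of_mem_segment h'.1
  have p0 : 0 < Real.sinh (dist a t) := Real.sinh_pos_iff.mpr (dist_pos.mpr hat)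
  have hD1 := left_ne_zero_of_mul hD.ne
  set α := Real.sinh (dist q t)
  set β := Real.sinh (dist a q)
  set α' := Real.sinh (dist q' t)
  set β' := Real.sinh (dist a q')
  set r := Real.sinh (dist a t)
  have hαβ : α * β' = α' * β := by
    refine mul_right_cancel₀ hD1 ?_
    linear_combination β' * e - β * e'
  have hcomp : ∀ i, α' * hyperboloid q i = α * hyperboloid q' i := by
    intro i
    have li := congrFun l i
    have li' := congrFun l' i
    simp only [Pi.add_apply, Pi.smul_apply, smul_eq_mul] at li li'
    refine mul_left_cancel₀ p0.ne' ?_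
    linear_combination α' * li - α * li' - hyperboloid t i * hαβ
  have hsq : α' ^ 2 = α ^ 2 := by
    have n := lorentz_hyperboloid_self q
    have n' := lorentz_hyperboloid_self q'
    simp only [lorentz] at n n'
    have h0 := hcomp 0
    have h1 := hcomp 1
    have h2 := hcomp 2
    have m02 : α' ^ 2 * (hyperboloid q 0 * hyperboloid q 2) =
        α ^ 2 * (hyperboloid q' 0 * hyperboloid q' 2) := by
      linear_combination α' * hyperboloid q 2 * h0 + α * hyperboloid q' 0 * h2
    have m11 : α' ^ 2 * (hyperboloid q 1 * hyperboloid q 1) =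
        α ^ 2 * (hyperboloid q' 1 * hyperboloid q' 1) := by
      linear_combination α' * hyperboloid q 1 * h1 + α * hyperboloid q' 1 * h1
    linear_combination m02 - m11 - α' ^ 2 * n + α ^ 2 * n'
  have heq : α' = α := (sq_eq_sq₀ p'.le p.le).mp hsq
  refine hyperboloid_injective (funext fun i => ?_)
  have := hcomp i
  rw [heq] at this
  exact mul_left_cancel₀ p.ne' this

theorem exists_hyperboloid_eq_smul (a t : ℍ) {k l : ℝ} (hk : 0 < k) (hl : 0 < l) :
    ∃ r : ℝ, 0 < r ∧ ∃ q : ℍ, hyperboloid q = r • (k • hyperboloid a + l • hyperboloid t) := by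
  set V := k • hyperboloid a + l • hyperboloid t with hV
  have hN : lorentz V V = k ^ 2 + l ^ 2 + 2 * k * l * Real.cosh (dist a t) := by
    have h1 := lorentz_hyperboloid_self a
    have h2 := lorentz_hyperboloid_self t
    have h3 := lorentz_hyperboloid a t
    simp only [lorentz, hV, Pi.add_apply, Pi.smul_apply, smul_eq_mul] at h1 h2 h3 ⊢
    linear_combination k ^ 2 * h1 + l ^ 2 * h2 + 2 * k * l * h3
  have hpos : 0 < lorentz V V := by
    rw [hN]
    have := Real.cosh_pos (dist a t)
    positivity
  refine ⟨(√(lorentz V V))⁻¹, by positivity, ?_⟩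
  apply exists_hyperboloid_eq
  · have ha := hyperboloid_zero_pos a
    have ht := hyperboloid_zero_pos t
    simp only [hV, Pi.add_apply, Pi.smul_apply, smul_eq_mul]
    positivity
  · have hs : √(lorentz V V) ^ 2 = lorentz V V := Real.sq_sqrt hpos.le
    have : lorentz ((√(lorentz V V))⁻¹ • V) ((√(lorentz V V))⁻¹ • V) =
        (√(lorentz V V) ^ 2)⁻¹ * lorentz V V := by
      generalize √(lorentz V V) = r
      simp only [lorentz, Pi.smul_apply, smul_eq_mul]
      ring
    rw [this, hs, inv_mul_cancel₀ hpos.ne']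

/-- Four vectors in dimension three satisfy det(t,b,s) a + det(a,s,b) t = det(a,s,t) b + det(a,t,b)
s. With positive coefficients, the normalised common value lies on both segments. -/
theorem exists_mem_segment_inter {a t b s : ℍ}
    (h1 : 0 < det3 (hyperboloid t) (hyperboloid b) (hyperboloid s))
    (h2 : 0 < det3 (hyperboloid a) (hyperboloid s) (hyperboloid b))
    (h3 : 0 < det3 (hyperboloid a) (hyperboloid s) (hyperboloid t))
    (h4 : 0 < det3 (hyperboloid a) (hyperboloid t) (hyperboloid b)) :
    ∃ q, q ∈ segment a t ∩ segment b s := by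
  obtain ⟨r, hr, q, hq⟩ := exists_hyperboloid_eq_smul a t h1 h2
  refine ⟨q, mem_segment_of_hyperboloid_eq (mul_pos hr h1).le (mul_pos hr h2).le ?_,
    mem_segment_of_hyperboloid_eq (mul_pos hr h3).le (mul_pos hr h4).le ?_⟩
  · rw [hq, smul_add, smul_smul, smul_smul]
  · rw [hq]
    ext i
    simp only [det3, Pi.add_apply, Pi.smul_apply, smul_eq_mul]
    fin_cases i <;> simp <;> ring

theorem exists_coeff_of_mem_openSegment {x y t : ℍ} (h : t ∈ openSegment x y) :
    ∃ α β : ℝ, 0 < α ∧ 0 < β ∧ hyperboloid t = α • hyperboloid x + β • hyperboloid y := by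
  obtain ⟨h1, h2⟩ := h
  rw [Set.mem_insert_iff, Set.mem_singleton_iff, not_or] at h2
  have e : dist x t + dist t y = dist x y := h1
  have d1 : 0 < dist x t := dist_pos.mpr (Ne.symm h2.1)
  have d2 : 0 < dist t y := dist_pos.mpr h2.2
  have s1 := Real.sinh_pos_iff.mpr d1
  have s2 := Real.sinh_pos_iff.mpr d2
  have s3 : 0 < Real.sinh (dist x y) := Real.sinh_pos_iff.mpr (by linarith)
  refine ⟨_, _, div_pos s2 s3, div_pos s1 s3, ?_⟩
  have := congrArg (fun V => (Real.sinh (dist x y))⁻¹ • V) (sinh_dist_smul_of_mem_segment h1)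
  simp only [smul_smul, smul_add, inv_mul_cancel₀ s3.ne', one_smul] at this
  rw [this, div_eq_inv_mul, div_eq_inv_mul]

/-! ### Orthogonal projections -/

theorem IsOrthogonalProjection.cosh_dist {x t z : ℍ} {ℓ : Set ℍ}
    (h : IsOrthogonalProjection x ℓ t) (hz : z ∈ ℓ) :
    Real.cosh (dist x z) = Real.cosh (dist x t) * Real.cosh (dist t z) :=
  cosh_dist_of_angle_eq_pi_div_two (h.2 z hz)

theorem IsOrthogonalProjection.unique {x t t' : ℍ} {ℓ : Set ℍ}
    (h : IsOrthogonalProjection x ℓ t) (h' : IsOrthogonalProjection x ℓ t') : t = t' := by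
  have e := h.cosh_dist h'.1
  have e' := h'.cosh_dist h.1
  rw [dist_comm t' t] at e'
  by_contra hne
  have h1 : 1 < Real.cosh (dist t t') := Real.one_lt_cosh.mpr (dist_ne_zero.mpr hne)
  have p := Real.cosh_pos (dist x t)
  have p' := Real.cosh_pos (dist x t')
  nlinarith

theorem IsOrthogonalProjection.infDist_segment {x a b t : ℍ}
    (h : IsOrthogonalProjection x (line a b) t) (ht : t ∈ segment a b) :
    Metric.infDist x (segment a b) = dist x t := by
  refine le_antisymm (Metric.infDist_le_dist_of_mem ht) ?_
  rw [Metric.le_infDist ⟨t, ht⟩]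
  intro z hz
  have e := h.cosh_dist (z := z) (Or.inl hz)
  have h1 := Real.one_le_cosh (dist t z)
  have h2 := Real.cosh_pos (dist x t)
  have h3 : Real.cosh (dist x t) ≤ Real.cosh (dist x z) := by rw [e]; nlinarith
  rwa [Real.cosh_le_cosh, abs_of_nonneg dist_nonneg, abs_of_nonneg dist_nonneg] at h3

/-- Pairing with x is linear along the segment, so the Pythagorean relation at b, with right angle
at s, passes to every q in [b, s]. -/
theorem cosh_dist_of_mem_segment {x s b q : ℍ} (hbs : b ≠ s) (hq : q ∈ segment b s)
    (h : Real.cosh (dist x b) = Real.cosh (dist x s) * Real.cosh (dist s b)) :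
    Real.cosh (dist x q) = Real.cosh (dist x s) * Real.cosh (dist q s) := by
  have e : dist b q + dist q s = dist b s := hq
  have l := sinh_dist_smul_of_mem_segment hq
  have l0 := congrFun l 0
  have l1 := congrFun l 1
  have l2 := congrFun l 2
  have m : Real.sinh (dist b s) * Real.cosh (dist x q) =
      Real.sinh (dist q s) * Real.cosh (dist x b) +
        Real.sinh (dist b q) * Real.cosh (dist x s) := by
    rw [← lorentz_hyperboloid, ← lorentz_hyperboloid, ← lorentz_hyperboloid]
    simp only [lorentz, Pi.add_apply, Pi.smul_apply, smul_eq_mul] at l0 l1 l2 ⊢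
    linear_combination (hyperboloid x 2 / 2) * l0 + (hyperboloid x 0 / 2) * l2 -
      hyperboloid x 1 * l1
  have p0 : Real.sinh (dist b s) ≠ 0 := by simpa using hbs
  refine mul_left_cancel₀ p0 ?_
  rw [m, h, dist_comm s b, ← e, Real.cosh_add, Real.sinh_add]
  linear_combination (-Real.cosh (dist x s) * Real.sinh (dist b q)) *
    Real.cosh_sq (dist q s)

/-! ### Right triangles with equal sums of hypotenuse and leg -/

/-- In a right triangle with hypotenuse r, legs a and d, and angle x between r and a, cos x = tanh a
/ tanh r. Expanding tanh r for r = w - a yields a quadratic equation for tanh a, whose smaller root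
is `gFun`. -/
theorem pFun_add_eq {a r x d : ℝ} (ha : 0 < a) (hr : 0 < r) (hd : 0 ≤ d)
    (hx : Real.cos x * (Real.sinh r * Real.sinh a) =
      Real.cosh r * Real.cosh a - Real.cosh d)
    (hcd : Real.cosh r = Real.cosh a * Real.cosh d) : pFun (a + r) x = d := by
  have sa := Real.sinh_pos_iff.mpr ha
  have sr := Real.sinh_pos_iff.mpr hr
  have ca := Real.cosh_pos a
  have cr := Real.cosh_pos r
  have qa := Real.cosh_sq a
  have qr := Real.cosh_sq r
  have cw := Real.cosh_pos (a + r)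
  have sw := Real.sinh_pos_iff.mpr (add_pos ha hr)
  have hc : Real.cos x = Real.sinh a * Real.cosh r / (Real.cosh a * Real.sinh r) := by
    rw [eq_div_iff (by positivity)]
    refine mul_left_cancel₀ sa.ne' ?_
    linear_combination Real.cosh a * hx + Real.cosh r * qa + hcd
  have htw : Real.tanh (a + r) = Real.sinh (a + r) / Real.cosh (a + r) :=
    Real.tanh_eq_sinh_div_cosh _
  have hta : Real.tanh a = Real.sinh a / Real.cosh a := Real.tanh_eq_sinh_div_cosh _
  have Wpos : 0 < Real.tanh (a + r) := by rw [htw]; positivity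
  have Wlt : Real.tanh (a + r) < 1 := Real.tanh_lt_one _
  have Xpos : 0 < Real.tanh a := by rw [hta]; positivity
  have Xlt : Real.tanh a < 1 := Real.tanh_lt_one _
  have cXge : Real.tanh a ≤ Real.cos x := by
    rw [hc, hta, div_le_div_iff₀ ca (by positivity)]
    have : Real.sinh r ≤ Real.cosh r := (Real.sinh_lt_cosh r).le
    have := mul_le_mul_of_nonneg_left this (mul_pos sa ca).le
    linarith
  have quad : Real.tanh (a + r) * Real.tanh a ^ 2 - (1 + Real.cos x) * Real.tanh a +
      Real.cos x * Real.tanh (a + r) = 0 := by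
    rw [hc, htw, hta, Real.sinh_add, Real.cosh_add]
    rw [Real.cosh_add] at cw
    field_simp
    ring
  have hg : gFun (a + r) x = Real.tanh a := by
    have hsq : (1 + Real.cos x) ^ 2 - 4 * Real.tanh (a + r) ^ 2 * Real.cos x =
        (1 + Real.cos x - 2 * Real.tanh (a + r) * Real.tanh a) ^ 2 := by
      linear_combination (-4 * Real.tanh (a + r)) * quad
    -- The root has this sign because tanh w · tanh a is below both 1 and cos x.
    rw [gFun, hsq, Real.sqrt_sq (by nlinarith)]
    field_simp
    ring
  have hroot : √(1 - Real.tanh (a + r) ^ 2) = 1 / Real.cosh (a + r) := by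
    rw [← Real.sqrt_sq (by positivity : (0 : ℝ) ≤ 1 / Real.cosh (a + r))]
    congr 1
    rw [htw]
    have := Real.cosh_sq (a + r)
    field_simp
    linarith
  rw [pFun, hg, hroot, ← Real.arcosh_cosh hd]
  congr 1
  -- Here (1 - tanh w tanh a) cosh w = cosh (w - a) / cosh a = cosh r / cosh a = cosh d.
  rw [htw, hta, eq_div_of_mul_eq ca.ne' ((mul_comm _ _).trans hcd.symm)]
  have : Real.cosh r = Real.cosh (a + r) * Real.cosh a - Real.sinh (a + r) * Real.sinh a := by
    rw [← Real.cosh_sub]; ring_nf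
  rw [this]
  field_simp

/-- Perpendiculars of equal length `dist a t = dist b s`, dropped from `a` to a line through `b`
and from `b` to a line through `a`, that meet in `q`. -/
theorem dist_eq_pFun_of_perpendiculars {a t b s q : ℍ} {w : ℝ}
    (hq : q ∈ segment a t ∩ segment b s) (hw : dist a t = w) (hw' : dist b s = w)
    (hat : Real.cosh (dist a b) = Real.cosh (dist a t) * Real.cosh (dist t b))
    (hbs : Real.cosh (dist b a) = Real.cosh (dist b s) * Real.cosh (dist s a))
    (haq : 0 < dist a q) (hqt : 0 < dist q t) (hqs : 0 < dist q s)
    (has : a ≠ s) :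
    dist a s = dist b t ∧ dist a s = pFun w (angle a q s) := by
  have ea : dist a q + dist q t = w := hw ▸ hq.1
  have eb : dist b q + dist q s = w := hw' ▸ hq.2
  have nat : a ≠ t := dist_pos.mp (by linarith)
  have nbs : b ≠ s := dist_pos.mp (by linarith)
  have heq : dist a s = dist b t := by
    rw [dist_comm a s, dist_comm b t]
    apply cosh_dist_injective
    rw [hw] at hat
    rw [hw', dist_comm b a, hat] at hbs
    exact (mul_left_cancel₀ (Real.cosh_pos w).ne' hbs).symm
  have e1 : Real.cosh (dist a q) = Real.cosh (dist a s) * Real.cosh (dist q s) := by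
    refine cosh_dist_of_mem_segment nbs hq.2 ?_
    rw [dist_comm a b, hbs, dist_comm b s, dist_comm s a, mul_comm]
  have e2 : Real.cosh (dist b q) = Real.cosh (dist b t) * Real.cosh (dist q t) := by
    refine cosh_dist_of_mem_segment nat hq.1 ?_
    rw [dist_comm b a, hat, dist_comm a t, dist_comm t b, mul_comm]
  have hlegs : dist q t = dist q s := by
    have e3 : Real.cosh (dist a q) * Real.cosh (dist q t) =
        Real.cosh (dist b q) * Real.cosh (dist q s) := by
      rw [e1, e2, heq]; ring
    -- Product-to-sum applied to `e3`: both pairs of distances have sum w, so only the differences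
    -- remain.
    have e4 : Real.cosh (dist a q - dist q t) = Real.cosh (dist b q - dist q s) := by
      have c1 := Real.cosh_add (dist a q) (dist q t)
      have c2 := Real.cosh_sub (dist a q) (dist q t)
      have c3 := Real.cosh_add (dist b q) (dist q s)
      have c4 := Real.cosh_sub (dist b q) (dist q s)
      rw [ea] at c1
      rw [eb] at c3
      linarith
    rw [← Real.cosh_abs, ← Real.cosh_abs (dist b q - dist q s)] at e4
    have e5 := Real.cosh_strictMonoOn.injOn (Set.mem_Ici.mpr (abs_nonneg _))
      (Set.mem_Ici.mpr (abs_nonneg _)) e4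
    rcases abs_eq_abs.mp e5 with h | h
    · linarith
    -- The other sign would make the hypotenuse [a, q] as long as the leg [q, s].
    · exfalso
      have h6 : dist a q = dist q s := by linarith
      have h7 : 1 < Real.cosh (dist a s) := Real.one_lt_cosh.mpr (dist_ne_zero.mpr has)
      have h8 := Real.cosh_pos (dist q s)
      rw [h6] at e1
      nlinarith
  refine ⟨heq, ?_⟩
  have hlaw := cos_angle_mul_sinh_mul_sinh a q s
  rw [dist_comm q a] at hlaw
  have := pFun_add_eq hqs haq dist_nonneg hlaw (by rw [e1, mul_comm])
  rw [← this]
  congr 1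
  linarith

/-! ### Polygons -/

theorem IsPolygon.det3_pos {n : ℕ} [NeZero n] {v : ZMod n → ℍ} (hv : IsPolygon v) (i : ZMod n)
    {a b : ℕ} (ha : 0 < a) (hab : a < b) (hb : b < n) :
    0 < det3 (hyperboloid (v i)) (hyperboloid (v (i + a))) (hyperboloid (v (i + b))) := by
  have hi := ZMod.val_lt i
  have val_of_lt : ∀ c : ℕ, i.val + c < n → (i + c : ZMod n).val = i.val + c := by
    intro c hc
    rw [ZMod.val_add, ZMod.val_natCast, Nat.add_mod_mod, Nat.mod_eq_of_lt hc]
  have val_of_ge : ∀ c : ℕ, c < n → n ≤ i.val + c → (i + c : ZMod n).val = i.val + c - n := by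
    intro c hc hc'
    rw [ZMod.val_add, ZMod.val_natCast, Nat.add_mod_mod, Nat.mod_eq_sub_mod hc',
      Nat.mod_eq_of_lt (by omega)]
  have pos := fun j k l h h' => (side_pos_iff _ _ _).mp (hv.positive j k l h h')
  -- The cases record which of the indices wrap past n; the determinant is invariant under the
  -- matching cyclic rotation.
  rcases lt_or_ge (i.val + b) n with h1 | h1
  · have va := val_of_lt a (by omega)
    have vb := val_of_lt b h1
    exact pos _ _ _ (by omega) (by omega)
  rcases lt_or_ge (i.val + a) n with h2 | h2
  · have va := val_of_lt a h2
    have vb := val_of_ge b hb h1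
    rw [det3_rotate, det3_rotate]
    exact pos _ _ _ (by omega) (by omega)
  · have va := val_of_ge a (by omega) h2
    have vb := val_of_ge b hb h1
    rw [det3_rotate]
    exact pos _ _ _ (by omega) (by omega)

theorem openSegment_self (x : ℍ) : openSegment x x = ∅ := by
  ext z
  simp only [openSegment, segment, Set.mem_sdiff, Set.mem_insert_iff, Set.mem_singleton_iff, or_self,
    Set.mem_empty_iff_false, iff_false, not_and, not_not]
  intro h
  change dist x z + dist z x = dist x x at h
  rw [dist_self, dist_comm x z] at h
  exact dist_eq_zero.mp (by linarith)

theorem ne_of_det3_pos {x y z : ℍ}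
    (h : 0 < det3 (hyperboloid x) (hyperboloid y) (hyperboloid z)) : x ≠ y := by
  rintro rfl
  rw [← det3_rotate, det3_right_self] at h
  exact h.false

/-- In a convex quadrilateral `a c d b` (or triangle, if `c = d`), cevians from `a` to the side
`[d, b]` and from `b` to the side `[a, c]` cross. -/
theorem crossing_of_mem_openSegment {a b c d t s : ℍ} (hs : s ∈ openSegment a c)
    (ht : t ∈ openSegment d b)
    (h1 : 0 < det3 (hyperboloid a) (hyperboloid c) (hyperboloid b))
    (h2 : 0 < det3 (hyperboloid a) (hyperboloid d) (hyperboloid b))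
    (h3 : 0 ≤ det3 (hyperboloid a) (hyperboloid c) (hyperboloid d))
    (h4 : 0 ≤ det3 (hyperboloid c) (hyperboloid d) (hyperboloid b)) :
    0 < det3 (hyperboloid t) (hyperboloid b) (hyperboloid s) ∧
    0 < det3 (hyperboloid a) (hyperboloid s) (hyperboloid b) ∧
    0 < det3 (hyperboloid a) (hyperboloid s) (hyperboloid t) ∧
    0 < det3 (hyperboloid a) (hyperboloid t) (hyperboloid b) := by
  obtain ⟨α, β, hα, hβ, es⟩ := exists_coeff_of_mem_openSegment hs
  obtain ⟨γ, δ, hγ, hδ, et⟩ := exists_coeff_of_mem_openSegment ht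
  have k1 : det3 (hyperboloid t) (hyperboloid b) (hyperboloid s) =
      γ * (α * det3 (hyperboloid a) (hyperboloid d) (hyperboloid b) +
        β * det3 (hyperboloid c) (hyperboloid d) (hyperboloid b)) := by
    rw [es, et]
    simp only [det3, Pi.add_apply, Pi.smul_apply, smul_eq_mul]
    ring
  have k2 : det3 (hyperboloid a) (hyperboloid s) (hyperboloid b) =
      β * det3 (hyperboloid a) (hyperboloid c) (hyperboloid b) := by
    rw [es]
    simp only [det3, Pi.add_apply, Pi.smul_apply, smul_eq_mul]
    ring
  have k3 : det3 (hyperboloid a) (hyperboloid s) (hyperboloid t) =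
      β * (γ * det3 (hyperboloid a) (hyperboloid c) (hyperboloid d) +
        δ * det3 (hyperboloid a) (hyperboloid c) (hyperboloid b)) := by
    rw [es, et]
    simp only [det3, Pi.add_apply, Pi.smul_apply, smul_eq_mul]
    ring
  have k4 : det3 (hyperboloid a) (hyperboloid t) (hyperboloid b) =
      γ * det3 (hyperboloid a) (hyperboloid d) (hyperboloid b) := by
    rw [et]
    simp only [det3, Pi.add_apply, Pi.smul_apply, smul_eq_mul]
    ring
  rw [k1, k2, k3, k4]
  refine ⟨?_, ?_, ?_, ?_⟩ <;> positivity

/-- The cevians `[v i, t i]` and `[v j, t j]`, where `j = i + (m + 1)`, of a polygon cross. -/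
theorem IsPolygon.cevians_crossing {m : ℕ} {v t : ZMod (2 * m + 1) → ℍ}
    (hv : IsPolygon v) (hm : 0 < m)
    (ht : ∀ i, t i ∈ openSegment (v (i + m)) (v (i + (m + 1 : ℕ)))) (i : ZMod (2 * m + 1)) :
    t (i + (m + 1 : ℕ)) ∈ openSegment (v i) (v (i + 1)) ∧
    0 < det3 (hyperboloid (t i)) (hyperboloid (v (i + (m + 1 : ℕ))))
      (hyperboloid (t (i + (m + 1 : ℕ)))) ∧
    0 < det3 (hyperboloid (v i)) (hyperboloid (t (i + (m + 1 : ℕ))))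
      (hyperboloid (v (i + (m + 1 : ℕ)))) ∧
    0 < det3 (hyperboloid (v i)) (hyperboloid (t (i + (m + 1 : ℕ)))) (hyperboloid (t i)) ∧
    0 < det3 (hyperboloid (v i)) (hyperboloid (t i)) (hyperboloid (v (i + (m + 1 : ℕ)))) := by
  have hzero : (2 * m + 1 : ZMod (2 * m + 1)) = 0 := by
    have := ZMod.natCast_self (2 * m + 1)
    push_cast at this
    exact this
  have hs : t (i + (m + 1 : ℕ)) ∈ openSegment (v i) (v (i + 1)) := by
    have h := ht (i + (m + 1 : ℕ))
    have i1 : i + (m + 1 : ℕ) + (m : ZMod (2 * m + 1)) = i := by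
      push_cast
      linear_combination hzero
    have i2 : i + (m + 1 : ℕ) + ((m + 1 : ℕ) : ZMod (2 * m + 1)) = i + 1 := by
      push_cast
      linear_combination hzero
    rwa [i1, i2] at h
  refine ⟨hs, crossing_of_mem_openSegment hs (ht i) ?_ ?_ ?_ ?_⟩
  · simpa using hv.det3_pos i (a := 1) (b := m + 1) (by omega) (by omega) (by omega)
  · exact hv.det3_pos i (a := m) (b := m + 1) (by omega) (by omega) (by omega)
  · rcases Nat.lt_or_ge 1 m with h | h
    -- For m = 1 the polygon is a triangle, v (i + 1) = v (i + m), and the determinant vanishes;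
    -- hence the weak inequalities.
    · simpa using (hv.det3_pos i (a := 1) (b := m) (by omega) (by omega) (by omega)).le
    · obtain rfl : m = 1 := by omega
      rw [Nat.cast_one, det3_right_self]
  · rcases Nat.lt_or_ge 1 m with h | h
    · have := (hv.det3_pos (i + 1) (a := m - 1) (b := m) (by omega) (by omega) (by omega)).le
      have i1 : i + 1 + ((m - 1 : ℕ) : ZMod (2 * m + 1)) = i + m := by
        rw [Nat.cast_sub (by omega)]
        push_cast
        ring
      have i2 : i + 1 + (m : ZMod (2 * m + 1)) = i + (m + 1 : ℕ) := by
        push_cast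
        ring
      rwa [i1, i2] at this
    · obtain rfl : m = 1 := by omega
      rw [Nat.cast_one, ← det3_rotate, det3_right_self]

end HypPolygon

end

theorem theorem4p1 (n : ℕ) [NeZero n] (v : ZMod n → UpperHalfPlane)
    (hv : HypPolygon.IsOrdinaryReduced v) (w : ℝ)
    (hw : w = HypPolygon.thickness (HypPolygon.convHull (Set.range v)))
    (t : ZMod n → UpperHalfPlane)
    (ht : ∀ i, HypPolygon.IsOrthogonalProjection (v i)
      (HypPolygon.line (v (i + ((n - 1) / 2 : ℕ))) (v (i + ((n + 1) / 2 : ℕ)))) (t i)) :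
    (∀ i, ∃! q, q ∈ HypPolygon.segment (v i) (t i) ∩
      HypPolygon.segment (v (i + ((n + 1) / 2 : ℕ))) (t (i + ((n + 1) / 2 : ℕ)))) ∧
    ∀ p : ZMod n → UpperHalfPlane,
      (∀ i, p i ∈ HypPolygon.segment (v i) (t i) ∩
        HypPolygon.segment (v (i + ((n + 1) / 2 : ℕ))) (t (i + ((n + 1) / 2 : ℕ)))) →
      HypPolygon.perimeter v =
        2 * ∑ i, HypPolygon.pFun w
          (HypPolygon.angle (v i) (p i) (t (i + ((n + 1) / 2 : ℕ)))) := by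
  open HypPolygon in
  obtain ⟨m, rfl⟩ := hv.odd
  have hfoot := hv.foot
  have hside := hv.dist_side
  have e1 : (2 * m + 1 - 1) / 2 = m := by omega
  have e2 : (2 * m + 1 + 1) / 2 = m + 1 := by omega
  simp only [e1, e2] at ht hfoot hside ⊢
  have hopen : ∀ i, t i ∈ openSegment (v (i + m)) (v (i + (m + 1 : ℕ))) := by
    intro i
    obtain ⟨t', h1, h2⟩ := hfoot i
    rwa [(ht i).unique h2]
  -- For m = 0 the opposite side degenerates to a point and has no relative interior to contain the
  -- foot.
  have hm : 0 < m := by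
    rcases Nat.eq_zero_or_pos m with rfl | h
    · have h := hopen 0
      have e : v (0 + (0 : ℕ)) = v (0 + (0 + 1 : ℕ)) :=
        congrArg v (Subsingleton.elim (α := ZMod 1) _ _)
      rw [e, openSegment_self] at h
      exact h.elim
    · exact h
  have hdist : ∀ i, dist (v i) (t i) = w := fun i => by
    rw [hw, ← hside i, (ht i).infDist_segment (hopen i).1]
  have hcross := IsPolygon.cevians_crossing hv.isPolygon hm hopen
  have hvt : ∀ i, v i ≠ t i := fun i => ne_of_det3_pos (hcross i).2.2.2.2
  -- The endpoints of each cevian lie strictly on opposite sides of the line of the other, which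
  -- gives uniqueness and keeps the crossing point away from the endpoints.
  have hD : ∀ i, det3 (hyperboloid (v (i + (m + 1 : ℕ)))) (hyperboloid (t (i + (m + 1 : ℕ))))
      (hyperboloid (v i)) * det3 (hyperboloid (v (i + (m + 1 : ℕ))))
      (hyperboloid (t (i + (m + 1 : ℕ)))) (hyperboloid (t i)) < 0 := by
    intro i
    obtain ⟨-, h1, h2, -, -⟩ := hcross i
    rw [← det3_rotate (hyperboloid (v i)), ← det3_rotate (hyperboloid (t i)),
      det3_swap (hyperboloid (v i))]
    exact mul_neg_of_neg_of_pos (neg_neg_of_pos h2) h1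
  have hD' : ∀ i, det3 (hyperboloid (v i)) (hyperboloid (t i))
      (hyperboloid (v (i + (m + 1 : ℕ)))) * det3 (hyperboloid (v i)) (hyperboloid (t i))
      (hyperboloid (t (i + (m + 1 : ℕ)))) < 0 := by
    intro i
    obtain ⟨-, -, -, h3, h4⟩ := hcross i
    rw [det3_swap _ (hyperboloid (t (i + (m + 1 : ℕ)))) (hyperboloid (t i))]
    exact mul_neg_of_pos_of_neg h4 (neg_neg_of_pos h3)
  refine ⟨fun i => ?_, fun p hp => ?_⟩
  · obtain ⟨-, h1, h2, h3, h4⟩ := hcross i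
    obtain ⟨q, hq⟩ := exists_mem_segment_inter h1 h2 h3 h4
    exact ⟨q, hq, fun q' hq' => eq_of_mem_segment_inter (hvt i) (hvt _) (hD i) hq' hq⟩
  · have key : ∀ i, dist (v i) (t (i + (m + 1 : ℕ))) = dist (v (i + (m + 1 : ℕ))) (t i) ∧
        dist (v i) (t (i + (m + 1 : ℕ))) = pFun w (angle (v i) (p i) (t (i + (m + 1 : ℕ)))) := by
      intro i
      have h := hp i
      obtain ⟨a1, a2⟩ := dist_pos_of_mem_segment_inter (hvt i) (hvt _) (hD i) h
      have b2 := (dist_pos_of_mem_segment_inter (hvt _) (hvt i) (hD' i) h.symm).2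
      have hA : v (i + (m + 1 : ℕ)) ∈ line (v (i + m)) (v (i + (m + 1 : ℕ))) :=
        Or.inl (right_mem_segment _ _)
      have hzero : (2 * m + 1 : ZMod (2 * m + 1)) = 0 := by
        have := ZMod.natCast_self (2 * m + 1)
        push_cast at this
        exact this
      have i1 : i + (m + 1 : ℕ) + (m : ZMod (2 * m + 1)) = i := by
        push_cast
        linear_combination hzero
      have hB := (ht (i + (m + 1 : ℕ))).cosh_dist (z := v i)
        (by rw [i1]; exact Or.inl (left_mem_segment _ _))
      exact dist_eq_pFun_of_perpendiculars h (hdist i) (hdist _) ((ht i).cosh_dist hA) hB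
        a1 a2 b2 (ne_of_det3_pos (hcross i).2.2.1)
    have hsplit : ∀ i, dist (v i) (v (i + 1)) =
        dist (v i) (t (i + (m + 1 : ℕ))) + dist (t (i + (m + 1 : ℕ))) (v (i + 1)) := fun i =>
      (hcross i).1.1.symm
    -- Equality of legs at index i + (m + 1), using 2(m + 1) = 1 modulo 2m + 1.
    have hsecond : ∀ i, dist (t (i + (m + 1 : ℕ))) (v (i + 1)) =
        dist (v (i + (m + 1 : ℕ))) (t (i + (m + 1 : ℕ) + (m + 1 : ℕ))) := by
      intro i
      rw [(key (i + (m + 1 : ℕ))).1, dist_comm]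
      congr 2
      have := ZMod.natCast_self (2 * m + 1)
      push_cast at this ⊢
      linear_combination -this
    rw [perimeter]
    simp only [hsplit, hsecond, ← (key _).2]
    refine Finset.sum_add_distrib.trans (Eq.trans ?_ (two_mul _).symm)
    congr 1
    exact Equiv.sum_comp (Equiv.addRight ((m + 1 : ℕ) : ZMod (2 * m + 1)))
      fun i => dist (v i) (t (i + (m + 1 : ℕ)))
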